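/- A digraph is a finite directed graph. A digraph $G$ is $2$-geodetic if for any (not necessarily distinct) vertices $u,v$ of $G$ there is at most one directed walk from $u$ to $v$ of length at most $2$ (the trivial walk from $u$ to $u$ has length $0$). A $(4,2;+1)$-digraph is a $2$-geodetic digraph with minimum out-degree $4$ and order $(1+4+4^2)+1 = 22$, that is, with exactly one vertex more than the directed Moore bound. Theorem. There are no $(4,2;+1)$-digraphs. -/

import Mathlib

namespace Digraph

/-- Directed walks in a digraph `G` from one vertex to another (vertices and arcs may repeat).
The trivial walk `nil` at a vertex has length `0`. -/
inductive DirWalk {V : Type*} (G : Digraph V) : V → V → Type _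
  | nil {u : V} : DirWalk G u u
  | cons {u v w : V} (h : G.Adj u v) (p : DirWalk G v w) : DirWalk G u w

/-- The length of a directed walk: the number of arcs it traverses. -/
def DirWalk.length {V : Type*} {G : Digraph V} : {u v : V} → G.DirWalk u v → ℕ
  | _, _, .nil => 0
  | _, _, .cons _ p => p.length + 1

/-- `G` is `k`-geodetic if for any (not necessarily distinct) vertices `u`, `v` there is at most
one directed walk from `u` to `v` of length at most `k`. -/
def IsGeodetic {V : Type*} (G : Digraph V) (k : ℕ) : Prop :=
  ∀ (u v : V) (p q : G.DirWalk u v), p.length ≤ k → q.length ≤ k → p = q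

/-- The out-degree of a vertex: the number of its out-neighbours (used for finite digraphs). -/
noncomputable def outDegree {V : Type*} (G : Digraph V) (u : V) : ℕ :=
  {v : V | G.Adj u v}.ncard

/-- The directed Moore bound `1 + d + d ^ 2 + ⋯ + d ^ k`. -/
def mooreBound (d k : ℕ) : ℕ :=
  ∑ i ∈ Finset.range (k + 1), d ^ i

/-- `G` is a `(d, k; +ε)`-digraph: a finite `k`-geodetic digraph with minimum out-degree `d` whose
order exceeds the directed Moore bound by the excess `ε`. -/
structure IsGeodeticWithExcess {V : Type*} (G : Digraph V) (d k ε : ℕ) : Prop where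
  finite : Finite V
  geodetic : G.IsGeodetic k
  minOutDegree : IsLeast (Set.range G.outDegree) d
  order : Nat.card V = mooreBound d k + ε

end Digraph

/-!
A vertex `u` of the digraph has out-degree exactly `4`, and its walks of length at most `2` reach
all vertices but one, its outlier `o u`. With the adjacency matrix `A`, the matrix `P` of `o` and
the all-ones matrix `J`, this says `1 + A + A ^ 2 + P = J`. The proof combines this equation with
the fact that an idempotent matrix has a natural number as its trace
(`Matrix.exists_trace_eq_of_quadratic`): on an invariant subspace where `A` satisfies
`x ^ 2 + x + s` without real roots, the two roots occur equally often, so the dimension is even.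

*Regularity.* `A` commutes with `J - P`. Comparing entries, a vertex of in-degree other than `4`
would leave only two outliers, with equal out-neighbourhoods, and identifying these gives a Moore
digraph of degree `4` and diameter `2`, which the trace rules out
(`IsOutlierMap.inDegree_eq_four`). So all in-degrees are `4`, and `o` is a permutation and an
automorphism.

*Fixed subsystems.* As short walks are unique, the fixed points of a power of `o` form a system of
the same kind (`IsOutlierSystem.fixed`), regular of some degree `d ≤ 4` and of order
`d ^ 2 + d + 2`, if there are any. The fixed points of `o ^ 2` are never adjacent
(`IsOutlierSystem.not_rel_of_fixed_sq`), because `A * (P - 1) / 2` is idempotent of trace zero when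
`o` is an involution.

*The order of `o`.* An automorphism of prime order `q ≥ 5` with a fixed vertex would fix
everything, and `q = 11`, the only such prime dividing `22`, is excluded by counting walks within
an orbit. The sizes of fixed subsystems modulo `2`-powers and `3` then exclude the prime `3`
(`IsOutlierSystem.pow_two_pow_succ_eq_one`) and lead to `o ^ 4 = 1`
(`IsOutlierSystem.pow_four_eq_one`). Finally `o` has one cycle of length `2` and five of length
`4`, and on the functions constant on these cycles and of sum zero, a space of dimension `5`, the
matrix `A` satisfies `A ^ 2 + A + 2 = 0`, which requires an even dimension.
-/

open Finset Matrix
open scoped Classical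

/-! ### Traces of idempotent matrices -/

theorem Matrix.exists_nat_eq_trace_of_isIdempotentElem {V K : Type*} [Fintype V] [Field K]
    {X : Matrix V V K} (hX : IsIdempotentElem X) : ∃ n : ℕ, X.trace = n := by
  have h : IsIdempotentElem (Matrix.toLin' X) := by
    rw [IsIdempotentElem, Module.End.mul_eq_comp, ← Matrix.toLin'_mul, hX.eq]
  exact ⟨_, by
    rw [← Matrix.trace_toLin'_eq]
    exact LinearMap.IsProj.trace (LinearMap.IsIdempotentElem.isProj_range _ h)⟩

theorem Matrix.eq_zero_of_isIdempotentElem_of_trace {V K : Type*} [Fintype V] [Field K]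
    [CharZero K] {X : Matrix V V K} (hX : IsIdempotentElem X) (h0 : X.trace = 0) : X = 0 := by
  have h : IsIdempotentElem (Matrix.toLin' X) := by
    rw [IsIdempotentElem, Module.End.mul_eq_comp, ← Matrix.toLin'_mul, hX.eq]
  have h1 := LinearMap.IsIdempotentElem.eq_zero_of_trace_eq_zero h
    (by rw [Matrix.trace_toLin'_eq, h0])
  simpa using h1

/-- If a real matrix `A` commutes with a projection `E` and satisfies a quadratic equation
`x ^ 2 + x + s` without real roots on the range of `E`, then the two conjugate roots occur there
equally often. Hence the rank of `E` is even, and every eigenvalue contributes its real part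
`-1 / 2` to the trace. -/
theorem Matrix.exists_trace_eq_of_quadratic {V : Type*} [Fintype V] {A E : Matrix V V ℝ} {s : ℝ}
    (hs : 1 / 4 < s) (hE : E * E = E) (hAE : A * E = E * A)
    (h : A * A * E + A * E + s • E = 0) :
    ∃ n : ℕ, E.trace = 2 * n ∧ (A * E).trace = -n := by
  set t : ℝ := √(s - 1 / 4) with ht
  have ht0 : 0 < t := Real.sqrt_pos.2 (by linarith)
  have htt : t * t = s - 1 / 4 := Real.mul_self_sqrt (by linarith)
  set x : ℂ := -1 / 2 - t * Complex.I with hx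
  set c : ℂ := 2 * t * Complex.I with hc
  have hc0 : c ≠ 0 := by simp [hc, ht0.ne']
  have hxx : x * x + x + s = 0 := by
    have h1 : (t : ℂ) * t = s - 1 / 4 := by
      rw [← Complex.ofReal_mul, htt]; push_cast; ring
    rw [hx]
    linear_combination h1 * Complex.I * Complex.I + (s - 1 / 4 : ℂ) * Complex.I_sq
  have hxc : 2 * x + c = -1 := by rw [hx, hc]; ring
  set B : Matrix V V ℂ := A.map (algebraMap ℝ ℂ) with hB
  set F : Matrix V V ℂ := E.map (algebraMap ℝ ℂ) with hF
  have hFF : F * F = F := by rw [hF, ← Matrix.map_mul, hE]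
  have hBF : B * F = F * B := by rw [hF, hB, ← Matrix.map_mul, hAE, Matrix.map_mul]
  have hq : B * B * F + B * F + (s : ℂ) • F = 0 := by
    have := congrArg (fun M : Matrix V V ℝ => M.map (algebraMap ℝ ℂ)) h
    simp only [Matrix.map_add _ (map_add (algebraMap ℝ ℂ)), Matrix.map_mul] at this
    rw [← hB, ← hF] at this
    convert this using 1
    · congr 1
      ext i j
      simp [hF]
    · ext i j; simp
  -- the spectral projection onto the eigenspace of the conjugate root `x + c`
  set Z : Matrix V V ℂ := c⁻¹ • (B * F - x • F) with hZ
  have hZZ : IsIdempotentElem Z := by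
    have h1 : (B * F - x • F) * (B * F - x • F) = c • (B * F - x • F) := by
      have e1 : B * F * (B * F) = B * B * F := by
        rw [mul_assoc, ← mul_assoc F, ← hBF, mul_assoc B F F, hFF, mul_assoc]
      have e2 : B * B * F = - (B * F) - (s : ℂ) • F := by
        rw [← sub_eq_zero, ← hq]; abel
      simp only [sub_mul, mul_sub, Matrix.smul_mul, Matrix.mul_smul, e1, hFF,
        mul_assoc B F F, ← hBF, ← mul_assoc F B F, e2]
      have e3 : c = -1 - 2 * x := by linear_combination hxc
      have e4 : (s : ℂ) = - (x * x) - x := by linear_combination hxx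
      rw [e3, e4]
      module
    rw [IsIdempotentElem, hZ, Matrix.smul_mul, Matrix.mul_smul, h1, smul_smul c⁻¹ c,
      inv_mul_cancel₀ hc0, one_smul]
  obtain ⟨n, hn⟩ := Matrix.exists_nat_eq_trace_of_isIdempotentElem hZZ
  have hF' : F.trace = (E.trace : ℂ) := by simp [hF, Matrix.trace]
  have hBF' : (B * F).trace = ((A * E).trace : ℂ) := by
    rw [hB, hF, ← Matrix.map_mul]; simp [Matrix.trace]
  have hmain : ((A * E).trace : ℂ) - x * E.trace = c * n := by
    rw [← hn, hZ, Matrix.trace_smul, Matrix.trace_sub, Matrix.trace_smul, hF', hBF',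
      smul_eq_mul, smul_eq_mul, mul_inv_cancel_left₀ hc0]
  have him := congrArg Complex.im hmain
  have hre := congrArg Complex.re hmain
  simp [hx, hc] at him hre
  have : E.trace = 2 * n := by
    have : t * (E.trace - 2 * n) = 0 := by linarith
    rcases mul_eq_zero.1 this with h | h
    · exact absurd h ht0.ne'
    · linarith
  exact ⟨n, this, by linarith⟩

/-! ### Matrices of functions and relations -/

/-- The matrix of a self-map `f`, acting on functions by `g ↦ g ∘ f`: row `u` has its only `1` in
column `f u`. -/
noncomputable def funMatrix {V : Type*} (f : V → V) : Matrix V V ℝ :=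
  Matrix.of fun u v => if f u = v then 1 else 0

/-- The adjacency matrix of a relation. -/
noncomputable def relMatrix {V : Type*} (r : V → V → Prop) : Matrix V V ℝ :=
  Matrix.of fun u v => if r u v then 1 else 0

/-- The all-ones matrix. -/
def onesMatrix (V : Type*) : Matrix V V ℝ := Matrix.of fun _ _ => 1

theorem funMatrix_id {V : Type*} : funMatrix (id : V → V) = 1 := by
  ext u v
  simp [funMatrix, Matrix.one_apply]

section
variable {V : Type*} [Fintype V]

theorem funMatrix_mul_apply (f : V → V) (M : Matrix V V ℝ) (u v : V) :
    (funMatrix f * M) u v = M (f u) v := by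
  simp [Matrix.mul_apply, funMatrix]

theorem funMatrix_mul_funMatrix (f g : V → V) :
    funMatrix f * funMatrix g = funMatrix (g ∘ f) := by
  ext u v
  rw [funMatrix_mul_apply]
  simp [funMatrix]

theorem funMatrix_mul_onesMatrix (f : V → V) :
    funMatrix f * onesMatrix V = onesMatrix V := by
  ext u v
  rw [funMatrix_mul_apply]
  simp [onesMatrix]

theorem onesMatrix_mul_funMatrix (f : Equiv.Perm V) :
    onesMatrix V * funMatrix f = onesMatrix V := by
  ext u v
  simp only [Matrix.mul_apply, funMatrix, onesMatrix, Matrix.of_apply, one_mul]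
  rw [Finset.sum_eq_single (f.symm v)]
  · simp
  · intro b _ hb
    rw [if_neg]
    rintro rfl
    simp at hb
  · simp

theorem onesMatrix_mul_self :
    onesMatrix V * onesMatrix V = (Fintype.card V : ℝ) • onesMatrix V := by
  ext u v
  simp [Matrix.mul_apply, onesMatrix]

theorem trace_onesMatrix : (onesMatrix V).trace = Fintype.card V := by
  simp [Matrix.trace, onesMatrix]

theorem trace_funMatrix (f : V → V) : (funMatrix f).trace = #{v | f v = v} := by
  simp [Matrix.trace, funMatrix]

theorem trace_relMatrix_mul_funMatrix (r : V → V → Prop) (f : V → V) :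
    (relMatrix r * funMatrix f).trace = #{v | r (f v) v} := by
  rw [Matrix.trace_mul_comm]
  simp [Matrix.trace, funMatrix_mul_apply, relMatrix]

theorem relMatrix_mul_funMatrix_apply (r : V → V → Prop) (f : V → V) (u v : V) :
    (relMatrix r * funMatrix f) u v = #{w | r u w ∧ f w = v} := by
  simp [Matrix.mul_apply, relMatrix, funMatrix, ← ite_and, Finset.sum_boole, and_comm]

theorem relMatrix_mul_self_apply (r : V → V → Prop) (u v : V) :
    (relMatrix r * relMatrix r) u v = #{w | r u w ∧ r w v} := by
  simp [Matrix.mul_apply, relMatrix, ← ite_and, Finset.sum_boole, and_comm]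

theorem relMatrix_mul_onesMatrix_apply (r : V → V → Prop) (u v : V) :
    (relMatrix r * onesMatrix V) u v = #{w | r u w} := by
  simp [Matrix.mul_apply, relMatrix, onesMatrix, Finset.sum_boole]

theorem onesMatrix_mul_relMatrix_apply (r : V → V → Prop) (u v : V) :
    (onesMatrix V * relMatrix r) u v = #{w | r w v} := by
  simp [Matrix.mul_apply, relMatrix, onesMatrix, Finset.sum_boole]

end

/-! ### Short walks and outliers -/

section
variable {V : Type*} [Fintype V]

/-- The number of walks of length at most `2` from `u` to `v` along the relation `r`. -/
noncomputable def walkCount (r : V → V → Prop) (u v : V) : ℕ :=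
  (if u = v then 1 else 0) + (if r u v then 1 else 0) + #{w | r u w ∧ r w v}

/-- `o` is an outlier map for `r` if every vertex `u` is joined to every vertex other than `o u` by
exactly one walk of length at most `2`, and to `o u` by none. -/
def IsOutlierMap (r : V → V → Prop) (o : V → V) : Prop :=
  ∀ u v, walkCount r u v + (if o u = v then 1 else 0) = 1

theorem sum_walkCount (r : V → V → Prop) (u : V) (S : Finset V) :
    ∑ v ∈ S, walkCount r u v =
      (if u ∈ S then 1 else 0) + #{v ∈ S | r u v} + ∑ w with r u w, #{v ∈ S | r w v} := by
  simp only [walkCount, Finset.sum_add_distrib]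
  congr 1
  · rw [Finset.sum_ite_eq, ← Finset.card_filter]
  · simp only [Finset.card_filter]
    rw [Finset.sum_comm, Finset.sum_filter]
    refine Finset.sum_congr rfl fun w _ => ?_
    by_cases h : r u w <;> simp [h]

section
variable {r : V → V → Prop} (h : ∀ u v, walkCount r u v ≤ 1)
include h

theorem not_rel_self_of_walkCount_le_one (u : V) : ¬ r u u := by
  intro h1
  have := h u u
  simp only [walkCount, h1, if_true] at this
  omega

theorem not_rel_symm_of_walkCount_le_one {u w : V} (h1 : r u w) : ¬ r w u := by
  intro h2
  have := h u u
  have h3 : 0 < #{w | r u w ∧ r w u} := Finset.card_pos.2 ⟨w, by simp [h1, h2]⟩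
  simp only [walkCount, if_true] at this
  omega

theorem not_rel_of_rel_of_rel_of_walkCount_le_one {u w v : V} (h1 : r u w) (h2 : r w v) :
    ¬ r u v := by
  intro h4
  have := h u v
  have h3 : 0 < #{w | r u w ∧ r w v} := Finset.card_pos.2 ⟨w, by simp [h1, h2]⟩
  simp only [walkCount, h4, if_true] at this
  omega

theorem eq_of_rel_of_rel_of_walkCount_le_one {u w w' v : V} (h1 : r u w) (h2 : r w v)
    (h3 : r u w') (h4 : r w' v) : w = w' := by
  have := h u v
  have h5 : #{w | r u w ∧ r w v} ≤ 1 := by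
    simp only [walkCount] at this
    omega
  exact Finset.card_le_one.1 h5 w (by simp [h1, h2]) w' (by simp [h3, h4])

end

namespace IsOutlierMap
variable {r : V → V → Prop} {o : V → V} (h : IsOutlierMap r o)
include h

theorem walkCount_le_one (u v : V) : walkCount r u v ≤ 1 := by
  have := h u v
  omega

theorem apply_ne (u : V) : o u ≠ u := by
  intro h1
  have := h u u
  simp [walkCount, h1] at this

theorem not_rel_apply (u : V) : ¬ r u (o u) := by
  intro h1
  have := h u (o u)
  simp [walkCount, h1] at this

theorem exists_rel_rel {u v : V} (h1 : u ≠ v) (h2 : o u ≠ v) (h3 : ¬ r u v) :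
    ∃ w, r u w ∧ r w v := by
  have := h u v
  simp only [walkCount, h1, h2, h3, if_false, zero_add, add_zero] at this
  obtain ⟨w, hw⟩ := Finset.card_pos.1 (this.symm ▸ Nat.one_pos)
  exact ⟨w, by simpa using hw⟩

theorem card_eq (u : V) :
    Fintype.card V = 1 + #{v | r u v} + ∑ w with r u w, #{v | r w v} + 1 := by
  have h1 : ∑ v, (walkCount r u v + (if o u = v then 1 else 0)) = ∑ _v : V, 1 :=
    Finset.sum_congr rfl fun v _ => h u v
  rw [Finset.sum_add_distrib, sum_walkCount] at h1
  simpa using h1.symm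

theorem matrix_eq :
    1 + relMatrix r + relMatrix r * relMatrix r + funMatrix o = onesMatrix V := by
  ext u v
  have := h u v
  simp only [walkCount] at this
  simp only [Matrix.add_apply, relMatrix_mul_self_apply]
  simp only [relMatrix, funMatrix, onesMatrix, Matrix.of_apply, Matrix.one_apply]
  exact_mod_cast this

/-- The adjacency matrix `A` commutes with `1 + A + A ^ 2`, the difference of the all-ones matrix
and the matrix of the outlier map; this is the resulting identity between entries. -/
theorem outDegree_add (u v : V) :
    #{w | r u w} + (if r (o u) v then 1 else 0) = #{w | r w v} + #{w | r u w ∧ o w = v} := by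
  have h1 : relMatrix r * onesMatrix V + funMatrix o * relMatrix r =
      onesMatrix V * relMatrix r + relMatrix r * funMatrix o := by
    rw [← h.matrix_eq]
    noncomm_ring
  have h2 := congrFun (congrFun h1 u) v
  simp only [Matrix.add_apply, relMatrix_mul_onesMatrix_apply, funMatrix_mul_apply,
    onesMatrix_mul_relMatrix_apply, relMatrix_mul_funMatrix_apply] at h2
  simp only [relMatrix, Matrix.of_apply] at h2
  exact_mod_cast h2

end IsOutlierMap

/-! ### In-degrees -/

namespace IsOutlierMap
variable {r : V → V → Prop} {o : V → V}

/-- If the outlier map took only two values `a ≠ b`, and these had the same out-neighbours, then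
identifying `a` with `b` would yield a Moore digraph of degree `4` and diameter `2`, whose
adjacency matrix `M` satisfies `M ^ 2 + M + 1 = J`. No such matrix has trace zero. The identified
digraph is represented on the original vertex set: `R` is the matrix of the retraction
`b ↦ a`, and plays the role of the identity. -/
theorem false_of_two_outliers (h : IsOutlierMap r o) (hV : Fintype.card V = 22)
    (hout : ∀ u, #{v | r u v} = 4) {a b : V} (hab : a ≠ b) (hro : ∀ u, o u = a ∨ o u = b)
    (hrab : ∀ v, r a v ↔ r b v) (hnab : ¬ r a b) : False := by
  set p : V → V := fun u => if u = b then a else u with hp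
  set c : V → V := fun _ => a with hc
  set A := relMatrix r with hA
  set J := onesMatrix V with hJ
  set R := funMatrix p with hR
  set C := funMatrix c with hC
  have hJJ : J * J = (22 : ℝ) • J := by rw [hJ, onesMatrix_mul_self, hV]; norm_num
  have hRR : R * R = R := by
    rw [hR, funMatrix_mul_funMatrix]
    congr 1
    ext u
    by_cases hu : u = b <;> simp [hp, hu, hab]
  have hRC : R * C = C := by rw [hR, hC, funMatrix_mul_funMatrix]; rfl
  have hCR : C * R = C := by
    rw [hR, hC, funMatrix_mul_funMatrix]
    congr 1
    ext u
    simp [hp, hc, hab]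
  have hCC : C * C = C := by rw [hC, funMatrix_mul_funMatrix]; rfl
  have hPR : funMatrix o * R = C := by
    rw [hR, hC, funMatrix_mul_funMatrix]
    congr 1
    ext u
    rcases hro u with hu | hu <;> simp [hp, hc, hab, hu]
  have hRJ : R * J = J := funMatrix_mul_onesMatrix _
  have hCJ : C * J = J := funMatrix_mul_onesMatrix _
  have hRA : R * A = A := by
    ext u v
    rw [hR, funMatrix_mul_apply]
    by_cases hu : u = b
    · simp [hp, hu, hA, relMatrix, hrab]
    · simp [hp, hu]
  have hAJ : A * J = (4 : ℝ) • J := by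
    ext u v
    rw [hA, hJ, relMatrix_mul_onesMatrix_apply, hout]
    simp [onesMatrix]
  have hcol : ∀ M : Matrix V V ℝ, ∀ u v, (M * C) u v = (M * J) u a * (if a = v then 1 else 0) := by
    intro M u v
    simp only [hC, hJ, funMatrix, onesMatrix, Matrix.mul_apply, hc, Matrix.of_apply,
      Finset.sum_mul, mul_one]
  have hAC : A * C = (4 : ℝ) • C := by
    ext u v
    rw [hcol, hAJ]
    simp [hC, funMatrix, hJ, onesMatrix, hc]
  have hJC : J * C = (22 : ℝ) • C := by
    ext u v
    rw [hcol, hJJ]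
    simp [hC, funMatrix, hJ, onesMatrix, hc]
  set K := J * R - C with hK
  have hKR : K * R = K := by rw [hK, sub_mul, mul_assoc, hRR, hCR]
  have hRK : R * K = K := by rw [hK, mul_sub, ← mul_assoc, hRJ, hRC]
  have hJK : J * K = (22 : ℝ) • K := by
    rw [hK, mul_sub, ← mul_assoc, hJJ, hJC, Matrix.smul_mul, smul_sub]
  have hCK : C * K = K := by rw [hK, mul_sub, ← mul_assoc, hCJ, hCC]
  have hKK : K * K = (21 : ℝ) • K := by
    calc K * K = J * (R * K) - C * K := by rw [← mul_assoc, ← sub_mul]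
      _ = (21 : ℝ) • K := by rw [hRK, hJK, hCK]; module
  set M := A * R with hM
  have hMR : M * R = M := by rw [hM, mul_assoc, hRR]
  have hRM : R * M = M := by rw [hM, ← mul_assoc, hRA]
  have hMM : M * M + M + R = K := by
    have h1 := congrArg (· * R) h.matrix_eq
    simp only [add_mul, one_mul, hPR, ← hA, ← hJ] at h1
    rw [hK, ← h1, hM, mul_assoc A R, ← mul_assoc R A R, hRA, ← mul_assoc]
    abel
  have hMK : M * K = (4 : ℝ) • K := by
    rw [hM, mul_assoc, hRK, hK, mul_sub, ← mul_assoc, hAJ, hAC, Matrix.smul_mul, smul_sub]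
  have hKM : K * M = (4 : ℝ) • K := by
    rw [← hMK, ← hMM]
    simp only [mul_add, add_mul, mul_assoc, hMR, hRM]
  set E := R - (1 / 21 : ℝ) • K with hE
  have hEE : E * E = E := by
    rw [hE]
    simp only [mul_sub, sub_mul, Matrix.mul_smul, Matrix.smul_mul, hRR, hRK, hKR, hKK]
    module
  have hME : M * E = M - (4 / 21 : ℝ) • K := by
    rw [hE, mul_sub, Matrix.mul_smul, hMR, hMK]
    module
  have hEM : E * M = M - (4 / 21 : ℝ) • K := by
    rw [hE, sub_mul, Matrix.smul_mul, hRM, hKM]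
    module
  have hquad : M * M * E + M * E + (1 : ℝ) • E = 0 := by
    have hRE : R * E = E := by rw [hE, mul_sub, Matrix.mul_smul, hRR, hRK]
    calc M * M * E + M * E + (1 : ℝ) • E = (M * M + M + R) * E := by
          rw [add_mul, add_mul, hRE, one_smul]
      _ = 0 := by
          rw [hMM, hE, mul_sub, Matrix.mul_smul, hKR, hKK]
          module
  have htrJR : (J * R).trace = 22 := by
    rw [Matrix.trace_mul_comm, hRJ, hJ, trace_onesMatrix, hV]
    norm_num
  have htrC : C.trace = 1 := by
    rw [hC, trace_funMatrix]
    simp [hc, Finset.filter_eq]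
  have htrR : R.trace = 21 := by
    rw [hR, trace_funMatrix]
    have : ({v | p v = v} : Finset V) = {b}ᶜ := by
      ext v
      by_cases hv : v = b <;> simp [hp, hv, hab]
    rw [this, Finset.card_compl, hV]
    norm_num
  have htrM : M.trace = 0 := by
    rw [hM, hA, hR, trace_relMatrix_mul_funMatrix]
    have h0 := not_rel_self_of_walkCount_le_one h.walkCount_le_one
    simp only [Nat.cast_eq_zero, Finset.card_eq_zero, Finset.filter_eq_empty_iff]
    intro v _
    by_cases hv : v = b
    · simpa [hp, hv] using hnab
    · simpa [hp, hv] using h0 v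
  obtain ⟨n, hn1, hn2⟩ := Matrix.exists_trace_eq_of_quadratic (by norm_num) hEE
    (hME.trans hEM.symm) hquad
  rw [hME, Matrix.trace_sub, Matrix.trace_smul, htrM, hK, Matrix.trace_sub, htrJR, htrC] at hn2
  rw [hE, Matrix.trace_sub, Matrix.trace_smul, htrR, hK, Matrix.trace_sub, htrJR, htrC] at hn1
  simp only [smul_eq_mul] at hn1 hn2
  linarith

/-- A vertex of in-degree greater than `4` would be an out-neighbour of every outlier; this would
force exactly two outliers, with equal out-neighbourhoods. -/
theorem inDegree_eq_four (h : IsOutlierMap r o) (hV : Fintype.card V = 22)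
    (hout : ∀ u, #{v | r u v} = 4) (v : V) : #{w | r w v} = 4 := by
  have hle := h.walkCount_le_one
  have hid : ∀ u v, 4 + (if r (o u) v then 1 else 0) = #{w | r w v} + #{w | r u w ∧ o w = v} := by
    intro u v
    rw [← h.outDegree_add, hout]
  by_contra hv
  obtain ⟨x, hx⟩ : ∃ x, 4 < #{w | r w x} := by
    by_contra! hx
    have h1 : ∑ x, #{w | r w x} = ∑ w, #{x | r w x} := by
      simp only [Finset.card_filter]
      exact Finset.sum_comm
    have h2 : ∑ x, #{w | r w x} < ∑ _x : V, 4 :=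
      Finset.sum_lt_sum (fun x _ => hx x) ⟨v, Finset.mem_univ v, lt_of_le_of_ne (hx v) hv⟩
    rw [h1] at h2
    simp [hout] at h2
  have hox : ∀ u, r (o u) x := by
    intro u
    have := hid u x
    by_contra h1
    rw [if_neg h1] at this
    omega
  -- outliers are not adjacent, as both are joined to `x`
  have hoo : ∀ u u', ¬ r (o u) (o u') := fun u u' h1 =>
    not_rel_of_rel_of_rel_of_walkCount_le_one hle h1 (hox u') (hox u)
  have hsame : ∀ u u' y, r (o u) y → r (o u') y := by
    intro u u' y hy
    have h0 : ∀ z, #{w | r z w ∧ o w = y} = 0 := by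
      intro z
      rw [Finset.card_eq_zero, Finset.filter_eq_empty_iff]
      rintro w _ ⟨-, rfl⟩
      exact hoo _ _ hy
    have h1 := hid u y
    have h2 := hid u' y
    rw [h0, if_pos hy] at h1
    rw [h0] at h2
    by_contra h3
    rw [if_neg h3] at h2
    omega
  set a := o v with ha
  refine h.false_of_two_outliers hV hout (h.apply_ne a).symm ?_
    (fun y => ⟨hsame v a y, hsame a v y⟩) (h.not_rel_apply a)
  intro u
  -- a third outlier `o u` would be reached from `a` through a common out-neighbour `w` of `a` and
  -- `o u`, giving the closed walk `o u → w → o u`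
  by_contra! hu
  obtain ⟨w, hw1, hw2⟩ := h.exists_rel_rel hu.1.symm hu.2.symm (hoo v u)
  exact not_rel_symm_of_walkCount_le_one hle (hsame v u w hw1) hw2

end IsOutlierMap
end

/-! ### Counting points by their period -/

theorem Equiv.Perm.pow_apply_apply_eq_iff {V : Type*} (o : Equiv.Perm V) (j : ℕ) (v : V) :
    (o ^ j) (o v) = o v ↔ (o ^ j) v = v := by
  rw [← Equiv.Perm.mul_apply, ← pow_succ, pow_succ', Equiv.Perm.mul_apply,
    EmbeddingLike.apply_eq_iff_eq]

section
variable {V : Type*} [Fintype V]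

theorem Equiv.Perm.dvd_card_of_dvd_minimalPeriod (g : Equiv.Perm V) {L : ℕ}
    (h : ∀ v, L ∣ Function.minimalPeriod g v) : L ∣ Fintype.card V := by
  rw [Fintype.card_congr (MulAction.selfEquivSigmaOrbits (Subgroup.zpowers g) V),
    Fintype.card_sigma]
  refine Finset.dvd_sum fun ω _ => ?_
  rw [← MulAction.minimalPeriod_eq_card]
  exact h _

/-- If all points of an invariant set have period dividing `q ^ n` but not `q ^ i`, then their
periods, and with them the size of the set, are divisible by `q ^ (i + 1)`. -/
theorem Equiv.Perm.pow_dvd_card (g : Equiv.Perm V) {p : V → Prop} [DecidablePred p]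
    (hp : ∀ v, p (g v) ↔ p v)
    {q n i : ℕ} (hq : q.Prime) (h1 : ∀ v, p v → (g ^ q ^ n) v = v)
    (h2 : ∀ v, p v → (g ^ q ^ i) v ≠ v) : q ^ (i + 1) ∣ #{v | p v} := by
  rw [← Fintype.card_subtype]
  refine Equiv.Perm.dvd_card_of_dvd_minimalPeriod (g.subtypePerm hp) fun v => ?_
  have key : ∀ m, Function.IsPeriodicPt (g.subtypePerm hp) m v ↔ (g ^ m) v = v := by
    intro m
    rw [Function.IsPeriodicPt, Function.IsFixedPt, Equiv.Perm.iterate_eq_pow,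
      Equiv.Perm.subtypePerm_pow, Subtype.ext_iff, Equiv.Perm.subtypePerm_apply]
  obtain ⟨k, -, hk⟩ := (Nat.dvd_prime_pow hq).1 ((key _).2 (h1 v v.2)).minimalPeriod_dvd
  rw [hk]
  refine pow_dvd_pow q ?_
  by_contra! hki
  refine h2 v v.2 ((key _).1 ?_)
  rw [Function.isPeriodicPt_iff_minimalPeriod_dvd, hk]
  exact pow_dvd_pow q (by omega)

theorem Equiv.Perm.dvd_card_not_fixed (g : Equiv.Perm V) {q n : ℕ} (hq : q.Prime)
    (h1 : g ^ q ^ n = 1) : q ∣ #{v | g v ≠ v} := by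
  have := g.pow_dvd_card (p := fun v => g v ≠ v) (fun v => by simp) (i := 0) (n := n) hq
    (fun v _ => by simp [h1]) (fun v hv => by simpa using hv)
  simpa using this

/-! ### Outlier systems and their fixed subsystems -/

/-- A relation with an outlier map that is a permutation and an automorphism of the relation. -/
structure IsOutlierSystem (r : V → V → Prop) (o : Equiv.Perm V) : Prop where
  rel_iff : ∀ u v, r (o u) (o v) ↔ r u v
  isOutlierMap : IsOutlierMap r o

namespace IsOutlierSystem
variable {r : V → V → Prop} {o : Equiv.Perm V} (h : IsOutlierSystem r o)
include h

theorem pow_rel_iff (n : ℕ) (u v : V) : r ((o ^ n) u) ((o ^ n) v) ↔ r u v := by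
  induction n with
  | zero => simp
  | succ n ih => rw [pow_succ', Equiv.Perm.mul_apply, Equiv.Perm.mul_apply, h.rel_iff, ih]

theorem zpow_rel_iff (n : ℤ) (u v : V) : r ((o ^ n) u) ((o ^ n) v) ↔ r u v := by
  cases n with
  | ofNat n => exact h.pow_rel_iff n u v
  | negSucc n =>
    rw [zpow_negSucc, ← h.pow_rel_iff (n + 1)]
    simp

/-- Since the adjacency matrix commutes with the matrix of `o`, it commutes with the all-ones
matrix, so that an outlier system is regular; its order follows. -/
theorem exists_degree [Nonempty V] :
    ∃ d, (∀ u, #{v | r u v} = d) ∧ Fintype.card V = d ^ 2 + d + 2 := by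
  have h1 : ∀ u v, #{w | r u w} = #{w | r w v} := by
    intro u v
    have h2 := h.isOutlierMap.outDegree_add u v
    have h3 : #{w | r u w ∧ o w = v} = if r (o u) v then 1 else 0 := by
      obtain ⟨v, rfl⟩ := o.surjective v
      rw [h.rel_iff]
      simp only [EmbeddingLike.apply_eq_iff_eq]
      split_ifs with hr
      · rw [Finset.card_eq_one]
        exact ⟨v, by ext w; simp; rintro rfl; exact hr⟩
      · rw [Finset.card_eq_zero, Finset.filter_eq_empty_iff]
        rintro w _ ⟨hw, rfl⟩
        exact hr hw
    omega
  obtain ⟨u⟩ := ‹Nonempty V›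
  have h2 : ∀ v, #{w | r v w} = #{w | r u w} := fun v => (h1 v u).trans (h1 u u).symm
  refine ⟨_, h2, ?_⟩
  rw [h.isOutlierMap.card_eq u, Finset.sum_congr rfl fun w _ => h2 w]
  simp
  ring

/-- The fixed points of a power of `o` form an outlier system: the short walk between two of
them is unique, hence itself fixed. -/
theorem fixed (j : ℕ) :
    IsOutlierSystem (fun u v : {v // (o ^ j) v = v} => r u v)
      (o.subtypePerm (p := fun v => (o ^ j) v = v) (o.pow_apply_apply_eq_iff j)) where
  rel_iff u v := h.rel_iff _ _
  isOutlierMap u v := by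
    refine Eq.trans ?_ (h.isOutlierMap u v)
    simp only [walkCount, Subtype.ext_iff, Equiv.Perm.subtypePerm_apply]
    congr 2
    refine Finset.card_bij (fun w _ => (w : V)) ?_ ?_ ?_
    · intro w hw
      simpa using hw
    · intro w _ w' _ hww
      exact Subtype.ext hww
    · intro w hw
      simp only [Finset.mem_filter, Finset.mem_univ, true_and] at hw
      refine ⟨⟨w, ?_⟩, by simpa using hw, rfl⟩
      have h1 := (h.pow_rel_iff j _ _).2 hw.1
      have h2 := (h.pow_rel_iff j _ _).2 hw.2
      rw [u.2] at h1
      rw [v.2] at h2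
      exact eq_of_rel_of_rel_of_walkCount_le_one h.isOutlierMap.walkCount_le_one h1 h2 hw.1 hw.2

theorem exists_fixed_degree {j : ℕ} {u : V} (hu : (o ^ j) u = u) :
    ∃ d, (∀ v, (o ^ j) v = v → #{w | r v w ∧ (o ^ j) w = w} = d) ∧
      #{v | (o ^ j) v = v} = d ^ 2 + d + 2 := by
  have : Nonempty {v // (o ^ j) v = v} := ⟨⟨u, hu⟩⟩
  obtain ⟨d, hd1, hd2⟩ := (h.fixed j).exists_degree
  refine ⟨d, fun v hv => ?_, by rw [← hd2, Fintype.card_subtype]⟩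
  rw [← hd1 ⟨v, hv⟩]
  symm
  refine Finset.card_bij (fun w _ => (w : V)) ?_ ?_ ?_
  · intro w hw
    simpa [w.2] using hw
  · intro w _ w' _ hww
    exact Subtype.ext hww
  · intro w hw
    simp only [Finset.mem_filter, Finset.mem_univ, true_and] at hw
    exact ⟨⟨w, hw.2⟩, by simpa using hw.1, rfl⟩

theorem relMatrix_mul_funMatrix_comm :
    relMatrix r * funMatrix o = funMatrix o * relMatrix r := by
  ext u v
  rw [funMatrix_mul_apply]
  obtain ⟨v, rfl⟩ := o.surjective v
  simp only [Matrix.mul_apply, relMatrix, funMatrix, Matrix.of_apply,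
    EmbeddingLike.apply_eq_iff_eq, h.rel_iff]
  simp

/-- If `o` is an involution with matrix `P`, then `A * (P - 1) / 2` is idempotent of trace zero.
So `A * P = A`, and out-neighbourhoods are closed under `o`; since `v` and `o v` have the same
out-neighbours, any arc would start two walks with the same ends. -/
theorem not_rel_of_sq_eq_one (ho : o ^ 2 = 1) (u v : V) : ¬ r u v := by
  set A := relMatrix r with hA
  set P := funMatrix o with hP
  set J := onesMatrix V with hJ
  have hoo : ∀ w, o (o w) = w := fun w => by
    rw [← Equiv.Perm.mul_apply, ← sq, ho, Equiv.Perm.one_apply]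
  have hAP : A * P = P * A := h.relMatrix_mul_funMatrix_comm
  have hPP : P * P = 1 := by
    rw [hP, funMatrix_mul_funMatrix, ← funMatrix_id]
    congr 1
    ext w
    exact hoo w
  have hJP : J * P = J := onesMatrix_mul_funMatrix o
  have hAA : A * A = J - 1 - A - P := by
    rw [hJ, ← h.isOutlierMap.matrix_eq]
    abel
  set X := (1 / 2 : ℝ) • (A * P - A) with hX
  have hXX : IsIdempotentElem X := by
    have h1 : (A * P - A) * (A * P - A) = (2 : ℝ) • (A * P - A) := by
      have e1 : A * P * (A * P) = A * A := by
        rw [mul_assoc, ← mul_assoc P, ← hAP, mul_assoc A P P, hPP, mul_one]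
      have e2 : A * P * A = A * A * P := by rw [mul_assoc, ← hAP, mul_assoc]
      have e3 : A * (A * P) = A * A * P := by rw [mul_assoc]
      rw [sub_mul, mul_sub, mul_sub, e1, e2, e3, hAA]
      simp only [sub_mul, hJP, hPP, one_mul]
      module
    rw [IsIdempotentElem, hX, Matrix.smul_mul, Matrix.mul_smul, h1]
    module
  have hirr := not_rel_self_of_walkCount_le_one h.isOutlierMap.walkCount_le_one
  have htrA : A.trace = 0 := by
    simp [Matrix.trace, hA, relMatrix, hirr]
  have htrAP : (A * P).trace = 0 := by
    rw [hA, hP, trace_relMatrix_mul_funMatrix]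
    simp only [Nat.cast_eq_zero, Finset.card_eq_zero, Finset.filter_eq_empty_iff]
    intro w _ hw
    refine h.isOutlierMap.not_rel_apply (o w) ?_
    rwa [hoo]
  have hX0 : X = 0 := Matrix.eq_zero_of_isIdempotentElem_of_trace hXX
    (by rw [hX, Matrix.trace_smul, Matrix.trace_sub, htrA, htrAP]; simp)
  have hAPA : P * A = A := by
    rw [← hAP]
    have : A * P - A = 0 := by simpa [hX] using hX0
    exact sub_eq_zero.1 this
  have hleft : ∀ w x, r (o w) x ↔ r w x := by
    intro w x
    have := congrFun (congrFun hAPA w) x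
    rw [hP, funMatrix_mul_apply] at this
    simp only [hA, relMatrix, Matrix.of_apply] at this
    by_cases h1 : r (o w) x <;> by_cases h2 : r w x <;> simp_all
  intro huv
  have : Nonempty V := ⟨u⟩
  obtain ⟨d, hd, -⟩ := h.exists_degree
  have hd0 : 0 < d := by
    rw [← hd u]
    exact Finset.card_pos.2 ⟨v, by simpa using huv⟩
  obtain ⟨w, hw⟩ := Finset.card_pos.1 ((hd v).symm ▸ hd0)
  have hvw : r v w := by simpa using hw
  have huov : r u (o v) := by rwa [← hleft, h.rel_iff]
  exact h.isOutlierMap.apply_ne v (eq_of_rel_of_rel_of_walkCount_le_one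
    h.isOutlierMap.walkCount_le_one huov ((hleft v w).2 hvw) huv hvw)

theorem not_rel_of_fixed_sq {u v : V} (hu : (o ^ 2) u = u) (hv : (o ^ 2) v = v) : ¬ r u v := by
  have h1 : (o.subtypePerm (p := fun v => (o ^ 2) v = v) (o.pow_apply_apply_eq_iff 2)) ^ 2 = 1 := by
    ext w
    rw [Equiv.Perm.subtypePerm_pow]
    simpa using w.2
  exact (h.fixed 2).not_rel_of_sq_eq_one h1 ⟨u, hu⟩ ⟨v, hv⟩

end IsOutlierSystem
end

/-! ### The order of the outlier automorphism -/

section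
variable {V : Type*} [Fintype V]

namespace IsOutlierSystem
variable {r : V → V → Prop} {o : Equiv.Perm V} (h : IsOutlierSystem r o)
  (hV : Fintype.card V = 22) (hout : ∀ u, #{v | r u v} = 4)

include hV in
omit h in
theorem card_fixed_add (g : Equiv.Perm V) : #{v | g v = v} + #{v | g v ≠ v} = 22 := by
  rw [← hV, ← Finset.card_univ]
  exact Finset.card_filter_add_card_filter_not _

include hV in
omit h in
theorem exists_fixed_sq {a : ℕ} (ho : o ^ 2 ^ a = 1) : ∃ u, (o ^ 2) u = u := by
  by_contra! hno
  have h1 := o.pow_dvd_card (p := fun _ => True) (i := 1) (n := a) (by simp)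
    Nat.prime_two (fun v _ => by rw [ho]; rfl) (fun v _ => by simpa using hno v)
  simp [hV] at h1

include h hV hout

theorem exists_fixed_degree_le {j : ℕ} {u : V} (hu : (o ^ j) u = u) :
    ∃ d ≤ 4, #{w | r u w ∧ (o ^ j) w = w} = d ∧ #{v | (o ^ j) v = v} = d ^ 2 + d + 2 ∧
      (d = 4 → o ^ j = 1) := by
  obtain ⟨d, hd1, hd2⟩ := h.exists_fixed_degree hu
  refine ⟨d, ?_, hd1 u hu, hd2, ?_⟩
  · rw [← hd1 u hu, ← hout u]
    exact Finset.card_le_card fun w hw => by simp at hw ⊢; exact hw.1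
  · rintro rfl
    have h1 := card_fixed_add hV (o ^ j)
    have h2 : #{v | (o ^ j) v ≠ v} = 0 := by omega
    rw [Finset.card_eq_zero, Finset.filter_eq_empty_iff] at h2
    ext v
    simpa using h2 (Finset.mem_univ v)

/-- An automorphism of prime order at least `5` that fixes a vertex fixes its four out-neighbours,
so that its fixed subsystem has degree `4` and is everything. -/
theorem pow_eq_one_of_fixed {j q : ℕ} (hq : q.Prime) (hq5 : 5 ≤ q) (hj : (o ^ j) ^ q = 1) {u : V}
    (hu : (o ^ j) u = u) : o ^ j = 1 := by
  have h1 := (o ^ j).pow_dvd_card (p := fun w => r u w ∧ (o ^ j) w ≠ w) (i := 0) (n := 1)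
    (fun v => by
      have := h.pow_rel_iff j u v
      rw [hu] at this
      simp [this]) hq (by simp [hj]) (by simp)
  have h2 : #{w | r u w ∧ (o ^ j) w = w} + #{w | r u w ∧ (o ^ j) w ≠ w} = 4 := by
    rw [← hout u, ← Finset.filter_filter, ← Finset.filter_filter]
    exact Finset.card_filter_add_card_filter_not _
  rw [zero_add, pow_one] at h1
  have h3 : #{w | r u w ∧ (o ^ j) w ≠ w} = 0 := Nat.eq_zero_of_dvd_of_lt h1 (by omega)
  obtain ⟨d, -, hd1, -, hd2⟩ := h.exists_fixed_degree_le hV hout hu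
  exact hd2 (by omega)

/-- An automorphism `φ` of order `11` would act freely with two orbits. As powers of `φ` commute, a
vertex has at most one out-neighbour in its own orbit, so there are more than `11` short walks
from a vertex into its orbit. -/
theorem false_of_pow_eleven {j : ℕ} (hj : (o ^ j) ^ 11 = 1) (hj1 : o ^ j ≠ 1) : False := by
  have hle := h.isOutlierMap.walkCount_le_one
  set φ := o ^ j with hφ
  have hq : Nat.Prime 11 := by norm_num
  have hfree : ∀ v, φ v ≠ v := fun v hv =>
    hj1 (h.pow_eq_one_of_fixed hV hout hq (by norm_num) hj hv)
  have hrel : ∀ (i : ℤ) u v, r ((φ ^ i) u) ((φ ^ i) v) ↔ r u v := by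
    intro i u v
    rw [hφ, ← zpow_natCast, ← _root_.zpow_mul]
    exact h.zpow_rel_iff _ u v
  have hdvd : ∀ u, 11 ∣ #{v | φ.SameCycle u v} := fun u => by
    simpa using φ.pow_dvd_card (p := fun v => φ.SameCycle u v) (i := 0) (n := 1)
      (fun v => by simp) hq (by simp [hj]) (fun v _ => by simpa using hfree v)
  have hge : ∀ u, 11 ≤ #{v | φ.SameCycle u v} := fun u =>
    Nat.le_of_dvd (Finset.card_pos.2 ⟨u, by simp [Equiv.Perm.SameCycle.refl]⟩) (hdvd u)
  have hone : ∀ u, #{v ∈ ({v | φ.SameCycle u v} : Finset V) | r u v} ≤ 1 := by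
    intro u
    rw [Finset.card_le_one]
    intro v hv w hw
    simp only [Finset.mem_filter, Finset.mem_univ, true_and] at hv hw
    obtain ⟨⟨i, rfl⟩, hv⟩ := hv
    obtain ⟨⟨k, rfl⟩, hw⟩ := hw
    have h1 := (hrel i _ _).2 hw
    have h2 := (hrel k _ _).2 hv
    rw [← Equiv.Perm.mul_apply, ← _root_.zpow_add, add_comm, _root_.zpow_add,
      Equiv.Perm.mul_apply] at h1
    exact eq_of_rel_of_rel_of_walkCount_le_one hle hv h1 hw h2
  have hsplit : ∀ u (S : Finset V), #{v ∈ S | r u v} + #{v ∈ Sᶜ | r u v} = 4 := by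
    intro u S
    rw [← hout u, ← Finset.card_union_of_disjoint, ← Finset.filter_union, Finset.union_compl]
    exact Finset.disjoint_filter_filter disjoint_compl_right
  have : Nonempty V := Fintype.card_pos_iff.1 (by omega)
  obtain ⟨u⟩ := this
  set O : Finset V := {v | φ.SameCycle u v} with hO
  have hmem : ∀ v, v ∈ O ↔ φ.SameCycle u v := fun v => by simp [hO]
  have hcompl : ∀ w, w ∉ O → Oᶜ = ({v | φ.SameCycle w v} : Finset V) := by
    intro w hw
    refine (Finset.eq_of_subset_of_card_le ?_ ?_).symm
    · intro v hv
      rw [Finset.mem_compl, hmem]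
      intro huv
      exact hw ((hmem w).2 (huv.trans (by simpa using hv : φ.SameCycle w v).symm))
    · rw [Finset.card_compl, hV]
      have h1 := hge u
      have h2 := hge w
      rw [← hO] at h1
      omega
  have hout3 : ∀ w, w ∉ O → 3 ≤ #{v ∈ O | r w v} := by
    intro w hw
    have h1 := hsplit w O
    have h2 := hone w
    rw [hcompl w hw] at h1
    omega
  have hin1 : ∀ w ∈ O, r u w → 1 ≤ #{v ∈ O | r w v} := by
    intro w hw huw
    obtain ⟨i, rfl⟩ := (hmem w).1 hw
    refine Finset.card_pos.2 ⟨(φ ^ i) ((φ ^ i) u), ?_⟩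
    rw [Finset.mem_filter, hmem, hrel]
    exact ⟨by simp [Equiv.Perm.SameCycle.refl], huw⟩
  have hcard : #O ≤ 11 := by
    obtain ⟨w, hw⟩ : ∃ w, w ∉ O := by
      by_contra! hall
      have h1 := hone u
      have h2 : O = Finset.univ := Finset.eq_univ_iff_forall.2 hall
      rw [← hO, h2, hout] at h1
      omega
    have h1 := hge w
    rw [← hcompl w hw, Finset.card_compl, hV] at h1
    omega
  have hsum : ∑ v ∈ O, walkCount r u v ≤ 11 :=
    (Finset.sum_le_card_nsmul O _ 1 fun v _ => hle u v).trans (by simpa using hcard)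
  rw [sum_walkCount, if_pos ((hmem u).2 (Equiv.Perm.SameCycle.refl _ _))] at hsum
  have hlow : #{v ∈ O | r u v} * 1 + #{v ∈ Oᶜ | r u v} * 3 ≤
      ∑ w with r u w, #{v ∈ O | r w v} := by
    have h1 : ({w | r u w} : Finset V) = {v ∈ O | r u v} ∪ {v ∈ Oᶜ | r u v} := by
      rw [← Finset.filter_union, Finset.union_compl]
    rw [h1, Finset.sum_union (Finset.disjoint_filter_filter disjoint_compl_right)]
    refine add_le_add ?_ ?_
    · refine Finset.card_nsmul_le_sum _ _ 1 fun w hw => ?_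
      rw [Finset.mem_filter] at hw
      exact hin1 w hw.1 hw.2
    · refine Finset.card_nsmul_le_sum _ _ 3 fun w hw => ?_
      rw [Finset.mem_filter, Finset.mem_compl] at hw
      exact hout3 w hw.1
  -- with `x ≤ 1` out-neighbours of `u` in `O`, there are at least
  -- `1 + x + x + 3 * (4 - x) = 13 - x` short walks from `u` into `O`
  have h1 := hsplit u O
  have h2 := hone u
  rw [← hO] at h2
  omega

theorem eq_two_or_three_of_prime_dvd_orderOf {q : ℕ} (hq : q.Prime) (hqo : q ∣ orderOf o) :
    q = 2 ∨ q = 3 := by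
  by_contra! hne
  have hq5 : 5 ≤ q := by
    have := hq.two_le
    have : q ≠ 4 := by rintro rfl; revert hq; decide
    omega
  obtain ⟨s, hs⟩ := hqo
  have hpos := orderOf_pos o
  have h1 : (o ^ s) ^ q = 1 := by rw [← pow_mul, mul_comm, ← hs, pow_orderOf_eq_one]
  have hs0 : 0 < s := Nat.pos_of_ne_zero (by rintro rfl; omega)
  have h2 : o ^ s ≠ 1 := pow_ne_one_of_lt_orderOf hs0.ne' (by rw [hs]; nlinarith)
  have h3 : q ∣ #{v | (o ^ s) v ≠ v} :=
    (o ^ s).dvd_card_not_fixed (n := 1) hq (by simpa using h1)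
  have h4 : #{v | (o ^ s) v = v} = 0 := by
    rw [Finset.card_eq_zero, Finset.filter_eq_empty_iff]
    exact fun v _ hv => h2 (h.pow_eq_one_of_fixed hV hout hq hq5 h1 hv)
  have h5 := card_fixed_add hV (o ^ s)
  rw [h4, zero_add] at h5
  rw [h5, show 22 = 2 * 11 from rfl, hq.dvd_mul, Nat.prime_dvd_prime_iff_eq hq Nat.prime_two,
    Nat.prime_dvd_prime_iff_eq hq (by norm_num)] at h3
  rcases h3 with rfl | rfl
  · exact hne.1 rfl
  · exact h.false_of_pow_eleven hV hout h1 h2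

theorem exists_pow_two_mul_pow_three : ∃ a b : ℕ, o ^ (2 ^ a * 3 ^ b) = 1 := by
  obtain ⟨a, m, hm, ho⟩ := Nat.exists_eq_two_pow_mul_odd (orderOf_pos o).ne'
  have hm3 : m = 3 ^ m.primeFactorsList.length := by
    refine Nat.eq_prime_pow_of_unique_prime_dvd (by rintro rfl; simp at hm) fun {q} hq hqm => ?_
    rcases h.eq_two_or_three_of_prime_dvd_orderOf hV hout hq
      (ho ▸ Dvd.dvd.mul_left hqm _) with rfl | rfl
    · exact absurd hqm hm.not_two_dvd_nat
    · rfl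
  exact ⟨a, _, by rw [← hm3, ← ho, pow_orderOf_eq_one]⟩

/-- If the order of `o` divides `2 ^ a * 3 ^ b`, then it divides `2 ^ (a + 1)`. Counting modulo
`4`, then modulo `3`, yields a fixed point `u` of `o ^ 2`. The power `o ^ (2 ^ (a + 1))` fixes
`u`, and its fixed subsystem has degree `1` or `4`. In degree `1`, the only fixed out-neighbour
of `u` would also be fixed by `o ^ 2`, whose fixed points are not adjacent. -/
theorem pow_two_pow_succ_eq_one {a b : ℕ} (ho : o ^ (2 ^ a * 3 ^ b) = 1) :
    o ^ 2 ^ (a + 1) = 1 := by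
  -- otherwise all cycle lengths of `o` would be divisible by `4`, which does not divide `22`
  have hex : ∃ u, (o ^ (2 * 3 ^ b)) u = u := by
    by_contra! hno
    have h1 := (o ^ 3 ^ b).pow_dvd_card (p := fun _ => True) (i := 1) (n := a) (by simp)
      Nat.prime_two (fun v _ => by rw [← pow_mul, mul_comm, ho]; rfl)
      (fun v _ => by rw [pow_one, ← pow_mul, mul_comm]; exact hno v)
    simp [hV] at h1
  obtain ⟨v, hv⟩ := hex
  obtain ⟨d, hd, -, hd2, -⟩ := h.exists_fixed_degree_le hV hout hv
  -- otherwise `3` would divide the size `d ^ 2 + d + 2` of a fixed subsystem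
  have hex : ∃ u, (o ^ 2) u = u := by
    by_contra! hno
    have h1 := (o ^ 2).pow_dvd_card (p := fun v => (o ^ (2 * 3 ^ b)) v = v) (i := 0) (n := b)
      (fun v => by
        rw [sq, Equiv.Perm.mul_apply, o.pow_apply_apply_eq_iff, o.pow_apply_apply_eq_iff])
      Nat.prime_three (fun v hv => by rw [← pow_mul]; exact hv)
      (fun v _ => by rw [pow_zero, pow_one]; exact hno v)
    rw [hd2] at h1
    interval_cases d <;> omega
  obtain ⟨u, hu⟩ := hex
  have hau : (o ^ 2 ^ (a + 1)) u = u := by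
    rw [pow_succ', pow_mul]
    exact Equiv.Perm.pow_apply_eq_self_of_apply_eq_self hu _
  obtain ⟨e, he, he1, he2, he4⟩ := h.exists_fixed_degree_le hV hout hau
  have h3 := (o ^ 2 ^ (a + 1)).dvd_card_not_fixed (n := b) Nat.prime_three
    (by rw [← pow_mul, pow_succ', mul_assoc, mul_comm, pow_mul, ho, one_pow])
  have h22 := card_fixed_add hV (o ^ 2 ^ (a + 1))
  -- `e ^ 2 + e + 2` and `22` agree modulo `3`
  have hcases : e = 1 ∨ e = 4 := by
    rw [he2] at h22
    interval_cases e <;> omega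
  rcases hcases with rfl | rfl
  · obtain ⟨w, hw⟩ := Finset.card_eq_one.1 he1
    have hmem : ∀ x, r u x ∧ (o ^ 2 ^ (a + 1)) x = x ↔ x = w := by
      intro x
      simpa using Finset.ext_iff.1 hw x
    have hw1 := (hmem w).2 rfl
    have hw2 : (o ^ 2) w = w := by
      rw [← hmem]
      constructor
      · have := (h.pow_rel_iff 2 u w).2 hw1.1
        rwa [hu] at this
      · rw [sq, Equiv.Perm.mul_apply, o.pow_apply_apply_eq_iff, o.pow_apply_apply_eq_iff]
        exact hw1.2
    exact absurd hw1.1 (h.not_rel_of_fixed_sq hu hw2)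
  · exact he4 rfl

/-- If `o` has order a power of two, then `o ^ 4` has at least `14` fixed points. The involution
`o ^ 2` acts freely on the out-neighbours, fixed by `o ^ 4`, of a fixed point of `o ^ 2`, so
that their number is even. -/
theorem pow_four_eq_one {a : ℕ} (ho : o ^ 2 ^ a = 1) : o ^ 4 = 1 := by
  obtain ⟨u, hu⟩ := exists_fixed_sq hV ho
  have hu4 : (o ^ 4) u = u := by
    rw [show 4 = 2 * 2 from rfl, pow_mul]
    exact Equiv.Perm.pow_apply_eq_self_of_apply_eq_self hu _
  obtain ⟨d, hd, hd1, hd2, hd4⟩ := h.exists_fixed_degree_le hV hout hu4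
  have h8 := o.pow_dvd_card (p := fun v => (o ^ 4) v ≠ v) (i := 2) (n := a)
    (fun v => not_congr (o.pow_apply_apply_eq_iff 4 v)) Nat.prime_two
    (fun v _ => by rw [ho]; rfl) (fun v hv => hv)
  have h22 := card_fixed_add hV (o ^ 4)
  have h2 := (o ^ 2).pow_dvd_card (p := fun w => r u w ∧ (o ^ 4) w = w) (i := 0) (n := 1)
    (fun v => by
      have := h.pow_rel_iff 2 u v
      rw [hu] at this
      rw [this, sq, Equiv.Perm.mul_apply, o.pow_apply_apply_eq_iff, o.pow_apply_apply_eq_iff])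
    Nat.prime_two (fun v hv => by rw [← pow_mul]; exact hv.2)
    (fun v hv hv2 => h.not_rel_of_fixed_sq hu (by simpa using hv2) hv.1)
  rw [hd1] at h2
  -- `d ^ 2 + d + 2` and `22` agree modulo `8`, so `d` is `3` or `4`; and `d` is even
  refine hd4 ?_
  rw [hd2] at h22
  interval_cases d <;> omega

/-- If `o ^ 4 = 1`, then `o` has five cycles of length `4` and one of length `2`. On the
functions constant on these six cycles and summing to zero, a space of odd dimension `5`, the
adjacency matrix satisfies `A ^ 2 + A + 2 = 0`, a quadratic without real roots. -/
theorem false_of_pow_four_eq_one (ho : o ^ 4 = 1) : False := by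
  set A := relMatrix r with hA
  set J := onesMatrix V with hJ
  set P := funMatrix o with hP
  have hPk : ∀ k : ℕ, P ^ k = funMatrix (o ^ k : Equiv.Perm V) := by
    intro k
    induction k with
    | zero => exact funMatrix_id.symm
    | succ k ih => rw [pow_succ, ih, hP, funMatrix_mul_funMatrix, pow_succ']; rfl
  have hP4 : P ^ 4 = 1 := by rw [hPk, ho]; exact funMatrix_id
  have hAP : A * P = P * A := h.relMatrix_mul_funMatrix_comm
  have hJP : J * P = J := onesMatrix_mul_funMatrix o
  have hPJ : P * J = J := funMatrix_mul_onesMatrix o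
  have hJJ : J * J = (22 : ℝ) • J := by rw [hJ, onesMatrix_mul_self, hV]; norm_num
  have hmat : 1 + A + A * A + P = J := h.isOutlierMap.matrix_eq
  have hAJ : A * J = J * A := by
    rw [← hmat]
    simp only [mul_add, add_mul, hAP, mul_assoc, one_mul, mul_one]
  set Q := 1 + P + P ^ 2 + P ^ 3 with hQ
  have hPQ : P * Q = Q := by
    calc P * Q = P + P ^ 2 + P ^ 3 + P ^ 4 := by rw [hQ]; noncomm_ring
      _ = Q := by rw [hP4, hQ]; abel
  have hQQ : Q * Q = (4 : ℝ) • Q := by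
    calc Q * Q = Q + P * Q + P * (P * Q) + P * (P * (P * Q)) := by
          nth_rw 1 [hQ]; noncomm_ring
      _ = (4 : ℝ) • Q := by simp only [hPQ]; module
  have hJQ : J * Q = (4 : ℝ) • J := by
    calc J * Q = J + J * P + J * P * P + J * P * P * P := by rw [hQ]; noncomm_ring
      _ = (4 : ℝ) • J := by simp only [hJP]; module
  have hQJ : Q * J = (4 : ℝ) • J := by
    calc Q * J = J + P * J + P * (P * J) + P * (P * (P * J)) := by rw [hQ]; noncomm_ring
      _ = (4 : ℝ) • J := by simp only [hPJ]; module
  have hAQ : A * Q = Q * A := by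
    have hc : Commute A P := hAP
    exact (((Commute.one_right A).add_right hc).add_right (hc.pow_right 2)).add_right
      (hc.pow_right 3)
  set E := (1 / 4 : ℝ) • Q - (1 / 22 : ℝ) • J with hE
  have hEE : E * E = E := by
    rw [hE]
    simp only [mul_sub, sub_mul, Matrix.mul_smul, Matrix.smul_mul, hQQ, hQJ, hJQ, hJJ]
    module
  have hAE : A * E = E * A := by
    rw [hE]
    simp only [mul_sub, sub_mul, Matrix.mul_smul, Matrix.smul_mul, hAQ, hAJ]
  have hJE : J * E = 0 := by
    rw [hE]
    simp only [mul_sub, Matrix.mul_smul, hJQ, hJJ]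
    module
  have hPE : P * E = E := by
    rw [hE]
    simp only [mul_sub, Matrix.mul_smul, hPQ, hPJ]
  have hquad : A * A * E + A * E + (2 : ℝ) • E = 0 := by
    calc A * A * E + A * E + (2 : ℝ) • E = E + A * E + A * A * E + P * E := by
          rw [hPE]; module
      _ = (1 + A + A * A + P) * E := by noncomm_ring
      _ = 0 := by rw [hmat, hJE]
  obtain ⟨n, hn, -⟩ := Matrix.exists_trace_eq_of_quadratic (by norm_num) hEE hAE hquad
  have ho1 : ∀ v, o v ≠ v := h.isOutlierMap.apply_ne
  have htr1 : P.trace = 0 := by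
    rw [hP, trace_funMatrix]
    simp [ho1]
  have htr3 : (P ^ 3).trace = 0 := by
    have ho3 : ∀ v, (o ^ 3) v ≠ v := by
      intro v hv
      have h1 : (o ^ 4) v = o v := by
        rw [show 4 = 3 + 1 from rfl, pow_succ', Equiv.Perm.mul_apply, hv]
      rw [ho] at h1
      exact ho1 v h1.symm
    rw [hPk, trace_funMatrix]
    simp [ho3]
  have htr2 : (P ^ 2).trace = 2 := by
    obtain ⟨u, hu⟩ := exists_fixed_sq hV (a := 2) ho
    obtain ⟨d, -, hd1, hd2, -⟩ := h.exists_fixed_degree_le hV hout hu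
    have hd0 : d = 0 := by
      rw [← hd1, Finset.card_eq_zero, Finset.filter_eq_empty_iff]
      exact fun w _ hw => h.not_rel_of_fixed_sq hu hw.2 hw.1
    rw [hPk, trace_funMatrix, hd2, hd0]
    norm_num
  have htrE : E.trace = 5 := by
    rw [hE, hQ, Matrix.trace_sub, Matrix.trace_smul, Matrix.trace_smul, Matrix.trace_add,
      Matrix.trace_add, Matrix.trace_add, htr1, htr2, htr3, hJ, trace_onesMatrix,
      Matrix.trace_one, hV]
    norm_num
  rw [htrE] at hn
  have : 5 = 2 * n := by exact_mod_cast hn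
  omega

end IsOutlierSystem
end

/-! ### Digraphs of excess one -/

section
variable {V : Type*} [Fintype V]

theorem Digraph.IsGeodetic.walkCount_le_one {G : Digraph V} (h : G.IsGeodetic 2) (u v : V) :
    walkCount G.Adj u v ≤ 1 := by
  have hnil : ∀ {u v : V} (huv : u = v) (q : G.DirWalk u v), q.length ≤ 2 → q.length = 0 := by
    rintro u _ rfl q hq
    rw [← h u u .nil q (by simp [DirWalk.length]) hq]
    rfl
  have h2 : #{w | G.Adj u w ∧ G.Adj w v} ≤ 1 := by
    rw [Finset.card_le_one]
    intro w hw w' hw'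
    simp only [Finset.mem_filter, Finset.mem_univ, true_and] at hw hw'
    have := h u v (.cons hw.1 (.cons hw.2 .nil)) (.cons hw'.1 (.cons hw'.2 .nil))
      (by simp [DirWalk.length]) (by simp [DirWalk.length])
    injection this
  by_cases huv : u = v
  · have h1 : ¬ G.Adj u v := fun ha => by
      simpa [DirWalk.length] using hnil huv (.cons ha .nil) (by simp [DirWalk.length])
    have h3 : #{w | G.Adj u w ∧ G.Adj w v} = 0 := by
      rw [Finset.card_eq_zero, Finset.filter_eq_empty_iff]
      intro w _ hw
      simpa [DirWalk.length] using
        hnil huv (.cons hw.1 (.cons hw.2 .nil)) (by simp [DirWalk.length])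
    rw [walkCount, if_pos huv, if_neg h1, h3]
  · by_cases ha : G.Adj u v
    · have h3 : #{w | G.Adj u w ∧ G.Adj w v} = 0 := by
        rw [Finset.card_eq_zero, Finset.filter_eq_empty_iff]
        intro w _ hw
        have := congrArg DirWalk.length (h u v (.cons ha .nil) (.cons hw.1 (.cons hw.2 .nil))
          (by simp [DirWalk.length]) (by simp [DirWalk.length]))
        simp [DirWalk.length] at this
      simp [walkCount, h3, huv, ha]
    · simpa [walkCount, huv, ha] using h2

/-- Counting walks of length at most `2` from a vertex: minimum out-degree `4` and order `22` leave
no room for a larger out-degree. -/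
theorem outDegree_eq_four {r : V → V → Prop} (hle : ∀ u v, walkCount r u v ≤ 1)
    (hV : Fintype.card V = 22) (hmin : ∀ u, 4 ≤ #{v | r u v}) (u : V) : #{v | r u v} = 4 := by
  have h1 : ∑ v, walkCount r u v ≤ 22 :=
    (Finset.sum_le_card_nsmul _ _ 1 fun v _ => hle u v).trans (by simp [hV])
  have h2 : #{v | r u v} * 4 ≤ ∑ w with r u w, #{v | r w v} :=
    Finset.card_nsmul_le_sum _ _ 4 fun w _ => hmin w
  rw [sum_walkCount, if_pos (Finset.mem_univ u)] at h1
  have := hmin u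
  omega

/-- The short walks from a vertex reach `1 + 4 + 16 = 21` of the `22` vertices. -/
theorem exists_isOutlierMap {r : V → V → Prop} (hle : ∀ u v, walkCount r u v ≤ 1)
    (hV : Fintype.card V = 22) (hout : ∀ u, #{v | r u v} = 4) : ∃ o, IsOutlierMap r o := by
  have key : ∀ u, ∃ x, ∀ v, walkCount r u v + (if x = v then 1 else 0) = 1 := by
    intro u
    have h1 : ∑ v, walkCount r u v = 21 := by
      rw [sum_walkCount, Finset.sum_congr rfl fun w _ => hout w]
      simp [hout]
    have h2 : ∑ v, (1 - walkCount r u v) = 1 := by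
      have : ∑ v, (1 - walkCount r u v) + ∑ v, walkCount r u v = 22 := by
        rw [← Finset.sum_add_distrib, Finset.sum_congr rfl fun v _ => Nat.sub_add_cancel (hle u v)]
        simp [hV]
      omega
    obtain ⟨x, -, hx⟩ : ∃ x ∈ Finset.univ, 1 - walkCount r u x ≠ 0 := by
      by_contra! hx
      rw [Finset.sum_eq_zero hx] at h2
      omega
    -- the numbers `1 - walkCount r u v` sum to `1`, so `x` is the only vertex not reached
    refine ⟨x, fun v => ?_⟩
    rw [← Finset.add_sum_erase _ _ (Finset.mem_univ x)] at h2
    by_cases hxv : x = v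
    · subst hxv
      simp only [if_true]
      omega
    · have h3 := Finset.single_le_sum (f := fun v => 1 - walkCount r u v)
        (fun _ _ => Nat.zero_le _) (Finset.mem_erase.2 ⟨Ne.symm hxv, Finset.mem_univ v⟩)
      have h4 := hle u v
      simp only [hxv, if_false] at h3 ⊢
      omega
  choose o ho using key
  exact ⟨o, ho⟩

/-- In a digraph that is regular in both directions the outlier map is a permutation, since its
matrix is then a combination of powers of the adjacency matrix and the all-ones matrix with
constant column sums; commuting with the adjacency matrix, it is an automorphism. -/
theorem IsOutlierMap.exists_isOutlierSystem {r : V → V → Prop} {o : V → V} (h : IsOutlierMap r o)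
    (hout : ∀ u, #{v | r u v} = 4) (hin : ∀ v, #{w | r w v} = 4) :
    ∃ p : Equiv.Perm V, IsOutlierSystem r p := by
  have hid : ∀ u v, (if r (o u) v then 1 else 0) = #{w | r u w ∧ o w = v} := by
    intro u v
    have := h.outDegree_add u v
    rw [hout, hin] at this
    omega
  have hr : ∀ u w, r u w → r (o u) (o w) := by
    intro u w huw
    by_contra hn
    have h1 := hid u (o w)
    rw [if_neg hn, eq_comm, Finset.card_eq_zero, Finset.filter_eq_empty_iff] at h1
    exact h1 (Finset.mem_univ w) ⟨huw, rfl⟩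
  have hinj : Function.Injective o := by
    have hJA : onesMatrix V * relMatrix r = (4 : ℝ) • onesMatrix V := by
      ext u v
      rw [onesMatrix_mul_relMatrix_apply, hin]
      simp [onesMatrix]
    have hJP : onesMatrix V * funMatrix o = ((Fintype.card V : ℝ) - 21) • onesMatrix V := by
      have h1 := congrArg (onesMatrix V * ·) h.matrix_eq
      simp only [mul_add, mul_one, ← mul_assoc, hJA, Matrix.smul_mul, onesMatrix_mul_self] at h1
      rw [← eq_sub_iff_add_eq'] at h1
      rw [h1]
      module
    intro x y hxy
    have hcard := h.card_eq x
    rw [Finset.sum_congr rfl fun w _ => hout w] at hcard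
    simp only [hout, Finset.sum_const, smul_eq_mul] at hcard
    have h2 := congrFun (congrFun hJP x) (o y)
    have h3 : #{w | o w = o y} = 1 := by
      rw [hcard] at h2
      norm_num [Matrix.mul_apply, onesMatrix, funMatrix, Finset.sum_boole] at h2
      exact_mod_cast h2
    exact Finset.card_le_one.1 h3.le x (by simpa using hxy) y (by simp)
  refine ⟨Equiv.ofBijective o (Finite.injective_iff_bijective.1 hinj),
    ⟨fun u w => ⟨?_, hr u w⟩, h⟩⟩
  intro huw
  have h1 := hid u (o w)
  rw [if_pos (show r (o u) (o w) from huw)] at h1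
  obtain ⟨x, hx⟩ := Finset.card_pos.1 (h1 ▸ Nat.one_pos)
  simp only [Finset.mem_filter, Finset.mem_univ, true_and] at hx
  exact hinj hx.2 ▸ hx.1

end

theorem mainTheorem3 {V : Type*} (G : Digraph V) : ¬ G.IsGeodeticWithExcess 4 2 1 := by
  intro hG
  have := hG.finite
  have := Fintype.ofFinite V
  have hV : Fintype.card V = 22 := by
    rw [← Nat.card_eq_fintype_card, hG.order]
    rfl
  have hle := hG.geodetic.walkCount_le_one
  have hmin : ∀ u, 4 ≤ #{v | G.Adj u v} := by
    intro u
    have := hG.minOutDegree.2 ⟨u, rfl⟩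
    rwa [Digraph.outDegree, Set.ncard_eq_toFinset_card', Set.toFinset_ofPred] at this
  have hout := outDegree_eq_four hle hV hmin
  obtain ⟨o, ho⟩ := exists_isOutlierMap hle hV hout
  obtain ⟨p, hp⟩ := ho.exists_isOutlierSystem hout (ho.inDegree_eq_four hV hout)
  obtain ⟨a, b, hab⟩ := hp.exists_pow_two_mul_pow_three hV hout
  exact hp.false_of_pow_four_eq_one hV hout
    (hp.pow_four_eq_one hV hout (hp.pow_two_pow_succ_eq_one hV hout hab))
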